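/- Let $G$ be a group generated by a finite set $X$ with $|X|\le d$, let $n\ge 1$, and let $E=\{e_1,\dots,e_n\}$ be the standard generating set of $\mathbb{Z}^n$. Let $G\wr\mathbb{Z}^n=\bigl(\bigoplus_{\mathbb{Z}^n}G\bigr)\rtimes\mathbb{Z}^n$ be the regular (restricted) wreath product, in which $\mathbb{Z}^n$ acts by translation of coordinates. Its natural generating set $X\cup E$ consists of the copies of the elements of $X$ in the coordinate of the identity of $\mathbb{Z}^n$ and of the elements of $E$ in the acting group. For a group $H$ and a subset $S\subseteq H$, a palindrome is an element represented by a word $s_1^{p_1}\cdots s_k^{p_k}$ with $s_j\in S$, $p_j\in\mathbb{Z}$, such that $s_j=s_{k-j+1}$ and $p_j=p_{k-j+1}$ for all $j$. The palindromic width $pw(H,S)$ is the least $m$ such that every element of $H$ is a product of at most $m$ palindromes ($\infty$ if there is no such $m$). Then $$pw(G\wr\mathbb{Z}^n,\,X\cup E)\le 5d+9n\quad\text{if } n \text{ is even},\qquad pw(G\wr\mathbb{Z}^n,\,X\cup E)\le 5d+9n+2\quad\text{if } n\text{ is odd}.$$ -/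

import Mathlib

/-- `g` is a palindrome with respect to `X`: it is represented by a word `x₁ ^ p₁ * ⋯ * x_k ^ p_k`
with letters `x_j ∈ X` and exponents `p_j ∈ ℤ` which reads the same backwards, that is
`x_j = x_{k - j + 1}` and `p_j = p_{k - j + 1}` for all `j`. -/
def IsPalindromeIn {G : Type*} [Group G] (X : Set G) (g : G) : Prop :=
  ∃ w : List (G × ℤ), (∀ s ∈ w, s.1 ∈ X) ∧ w.reverse = w ∧ (w.map fun s => s.1 ^ s.2).prod = g

/-- Every element of `G` is a product of at most `m` palindromes with respect to `X`. -/
def IsPalindromicBound {G : Type*} [Group G] (X : Set G) (m : ℕ) : Prop :=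
  ∀ g : G, ∃ l : List G, l.length ≤ m ∧ (∀ p ∈ l, IsPalindromeIn X p) ∧ l.prod = g

/-- The palindromic width `pw(G, X)`: the least `m` such that every element of `G` is a product of
at most `m` palindromes with respect to `X`, and `⊤` if there is no such `m`. -/
noncomputable def palindromicWidth {G : Type*} [Group G] (X : Set G) : ℕ∞ :=
  ⨅ (m : ℕ) (_ : IsPalindromicBound X m), (m : ℕ∞)

/-- The (restricted, regular) wreath product `D ≀ Q`, that is `(⨁_Q D) ⋊ Q`, as the subgroup of
Mathlib's unrestricted wreath product `D ≀ᵣ Q` formed by the pairs `(f, q)` for which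
`f : Q → D` has finite support. -/
def restrictedWreath (D Q : Type*) [Group D] [Group Q] : Subgroup (D ≀ᵣ Q) where
  carrier := {a | (Function.mulSupport a.left).Finite}
  one_mem' := by simp
  mul_mem' := by
    intro a b ha hb
    refine (Set.Finite.union ha
      (hb.preimage (mul_right_injective a.right⁻¹).injOn)).subset ?_
    exact Function.mulSupport_mul _ _
  inv_mem' := by
    intro a ha
    refine (ha.preimage (mul_right_injective a.right).injOn).subset ?_
    intro x hx
    simpa using hx

namespace restrictedWreath

variable {D Q : Type*} [Group D] [Group Q]

open Classical in
/-- The copy of `y ∈ D` in `D ≀ Q`: the function with value `y` at `1 ∈ Q` and `1` elsewhere. -/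
noncomputable def ofBase (y : D) : restrictedWreath D Q :=
  ⟨⟨Pi.mulSingle 1 y, 1⟩, (Set.finite_singleton 1).subset Pi.mulSupport_mulSingle_subset⟩

/-- The copy of `q ∈ Q` in `D ≀ Q`. -/
def ofTop (q : Q) : restrictedWreath D Q :=
  ⟨⟨1, q⟩, by simp [restrictedWreath]⟩

/-- The natural generating set of `D ≀ Q` coming from `Y ⊆ D` and `T ⊆ Q`. -/
def naturalGenerators (Y : Set D) (T : Set Q) : Set (restrictedWreath D Q) :=
  ofBase '' Y ∪ ofTop '' T

end restrictedWreath

/-- The standard generating set of `ℤⁿ`, written multiplicatively. -/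
def standardGenerators (n : ℕ) : Set (Multiplicative (Fin n → ℤ)) :=
  Set.range fun i => Multiplicative.ofAdd (Pi.single i 1)

/-! Write an element as `base f * topHom q`. The translation `q` costs `n` palindromes, one power of
each `e_i`. A commutator `⁅g, s⁆` with a generator `s` costs three: `g s g⁻¹` is two and `s⁻¹` is
one.

For `s = e_i` and `g` in the base, this commutator is a difference along direction `i`. Solving the
difference equation by partial products from both ends of each line clears `f` off the hyperplane
`z_i = 0` (`exists_telescope`). After all directions, at a cost of `3n`, only a value `y ∈ G` at the
identity remains.

Modulo the commutator subgroup, `y` is a product of `|X|` powers of generators. The remaining factor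
has the form `u₁⁻¹ ⋯ u_k⁻¹` with `u₁ ⋯ u_k = 1`, and is two commutators with one `e_i`
(`baseHom_eq_mul_commutators`), hence six palindromes. The total `|X| + 4n + 6` lies below both
stated bounds. -/

section Palindromes

/-! ### Products of palindromes in a general group -/

variable {H : Type*} [Group H] {S : Set H}

/-- `g` is a product of at most `m` palindromes with respect to `S`. -/
def IsPalindromeProduct (S : Set H) (m : ℕ) (g : H) : Prop :=
  ∃ l : List H, l.length ≤ m ∧ (∀ p ∈ l, IsPalindromeIn S p) ∧ l.prod = g

lemma IsPalindromeProduct.mul {m k : ℕ} {g h : H} (hg : IsPalindromeProduct S m g)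
    (hh : IsPalindromeProduct S k h) : IsPalindromeProduct S (m + k) (g * h) := by
  obtain ⟨l, h1, h2, rfl⟩ := hg
  obtain ⟨l', h1', h2', rfl⟩ := hh
  refine ⟨l ++ l', by simp; omega, fun p hp => ?_, by simp⟩
  rcases List.mem_append.1 hp with h | h
  exacts [h2 p h, h2' p h]

lemma IsPalindromeProduct.mono {m k : ℕ} {g : H} (hg : IsPalindromeProduct S m g) (h : m ≤ k) :
    IsPalindromeProduct S k g := by
  obtain ⟨l, h1, h2, h3⟩ := hg
  exact ⟨l, h1.trans h, h2, h3⟩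

lemma IsPalindromeIn.isPalindromeProduct {g : H} (hg : IsPalindromeIn S g) :
    IsPalindromeProduct S 1 g :=
  ⟨[g], by simp, by simpa using hg, by simp⟩

lemma isPalindromeProduct_list_prod {ι : Type*} {k : ℕ} (l : List ι) (φ : ι → H)
    (h : ∀ i ∈ l, IsPalindromeProduct S k (φ i)) :
    IsPalindromeProduct S (k * l.length) (l.map φ).prod := by
  induction l with
  | nil => exact ⟨[], by simp, by simp, by simp⟩
  | cons a l ih =>
    simp only [List.map_cons, List.prod_cons, List.length_cons]
    exact ((h a (by simp)).mul (ih fun i hi => h i (by simp [hi]))).mono (by ring_nf; rfl)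

lemma isPalindromeIn_zpow {s : H} (hs : s ∈ S) (p : ℤ) : IsPalindromeIn S (s ^ p) :=
  ⟨[(s, p)], by simpa using hs, by simp, by simp⟩

lemma exists_word_of_mem_closure {g : H} (hg : g ∈ Subgroup.closure S) :
    ∃ w : List (H × ℤ), (∀ s ∈ w, s.1 ∈ S) ∧ (w.map fun s => s.1 ^ s.2).prod = g := by
  induction hg using Subgroup.closure_induction_right with
  | one => exact ⟨[], by simp, by simp⟩
  | mul_right x _ y hy ih =>
    obtain ⟨w, h1, rfl⟩ := ih
    refine ⟨w ++ [(y, 1)], fun s hs => ?_, by simp⟩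
    rcases List.mem_append.1 hs with h | h
    · exact h1 s h
    · rw [List.mem_singleton.1 h]; exact hy
  | mul_inv_cancel x _ y hy ih =>
    obtain ⟨w, h1, rfl⟩ := ih
    refine ⟨w ++ [(y, -1)], fun s hs => ?_, by simp⟩
    rcases List.mem_append.1 hs with h | h
    · exact h1 s h
    · rw [List.mem_singleton.1 h]; exact hy

lemma prod_map_zpow_neg_reverse (w : List (H × ℤ)) :
    ((w.map fun s => (s.1, -s.2)).reverse.map fun s => s.1 ^ s.2).prod =
      (w.map fun s => s.1 ^ s.2).prod⁻¹ := by
  rw [List.prod_inv_reverse]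
  simp [List.map_reverse, Function.comp_def]

/-- A conjugate of a power of a generator is a product of two palindromes. -/
lemma isPalindromeProduct_conj {g s : H} (hg : g ∈ Subgroup.closure S) (hs : s ∈ S) (p : ℤ) :
    IsPalindromeProduct S 2 (g * s ^ p * g⁻¹) := by
  obtain ⟨w, hw, rfl⟩ := exists_word_of_mem_closure hg
  set v := w.map fun s => (s.1, -s.2) with hv
  have hvS : ∀ s ∈ v, s.1 ∈ S := by
    intro s hs
    obtain ⟨a, ha, rfl⟩ := List.mem_map.1 hs
    exact hw a ha
  have e1 : (v.reverse.map fun s => s.1 ^ s.2).prod = (w.map fun s => s.1 ^ s.2).prod⁻¹ :=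
    prod_map_zpow_neg_reverse w
  have e2 : (v.map fun s => s.1 ^ s.2).prod = (w.reverse.map fun s => s.1 ^ s.2).prod⁻¹ := by
    rw [← prod_map_zpow_neg_reverse, ← List.map_reverse, List.reverse_reverse]
  -- With `w̄` the reversed word, `w s^p w⁻¹ = (w s^p w̄) (w̄⁻¹ w⁻¹)`, and both factors are
  -- palindromes.
  have h1 : IsPalindromeIn S
      (((w ++ [(s, p)]) ++ w.reverse).map fun s => s.1 ^ s.2).prod := by
    refine ⟨_, fun a ha => ?_, by simp, rfl⟩
    simp only [List.mem_append, List.mem_singleton, List.mem_reverse] at ha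
    rcases ha with (h | rfl) | h
    exacts [hw a h, hs, hw a h]
  have h2 : IsPalindromeIn S ((v ++ v.reverse).map fun s => s.1 ^ s.2).prod := by
    refine ⟨_, fun a ha => ?_, by simp, rfl⟩
    simp only [List.mem_append, List.mem_reverse, or_self] at ha
    exact hvS a ha
  have h3 := h1.isPalindromeProduct.mul h2.isPalindromeProduct
  convert h3 using 1
  · simp only [List.map_append, List.prod_append, List.prod_cons, List.prod_nil, List.map_cons,
      List.map_nil, e1, e2]
    group

open scoped commutatorElement in
lemma isPalindromeProduct_commutator {g s : H} (hg : g ∈ Subgroup.closure S) (hs : s ∈ S) :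
    IsPalindromeProduct S 3 ⁅g, s⁆ := by
  have h := (isPalindromeProduct_conj hg hs 1).mul (isPalindromeIn_zpow hs (-1)).isPalindromeProduct
  simpa [commutatorElement_def] using h

end Palindromes

/-! ### The commutator subgroup and the abelianization -/

section Commutators

variable {G : Type*} [Group G]

/-- An element of the commutator subgroup is `u₁⁻¹ ⋯ u_k⁻¹` for some `u₁ ⋯ u_k = 1`. -/
lemma exists_list_prod_eq_one_of_mem_commutator {c : G} (hc : c ∈ commutator G) :
    ∃ L : List G, L.prod = 1 ∧ (L.map (·⁻¹)).prod = c := by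
  rw [commutator_eq_closure] at hc
  induction hc using Subgroup.closure_induction_right with
  | one => exact ⟨[], by simp, by simp⟩
  | mul_right x _ y hy ih =>
    obtain ⟨L, h1, rfl⟩ := ih
    obtain ⟨a, b, rfl⟩ := hy
    -- The three new entries multiply to `1`, while their inverses multiply to `a b (b a)⁻¹ = ⁅a,
    -- b⁆`.
    exact ⟨L ++ [a⁻¹, b⁻¹, b * a], by simp [h1], by simp [commutatorElement_def, mul_assoc]⟩
  | mul_inv_cancel x _ y hy ih =>
    obtain ⟨L, h1, rfl⟩ := ih
    obtain ⟨a, b, rfl⟩ := hy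
    exact ⟨L ++ [b⁻¹, a⁻¹, a * b], by simp [h1], by simp [commutatorElement_def, mul_assoc]⟩

/-- In the abelianization the letters of a word for `g` can be collected, leaving one power per
generator. -/
lemma exists_mem_commutator_mul_prod_zpow (X : Finset G)
    (hX : Subgroup.closure (X : Set G) = ⊤) (g : G) :
    ∃ c ∈ commutator G, ∃ a : G → ℤ, g = c * (X.toList.map fun x => x ^ a x).prod := by
  have key : ∃ a : G → ℤ, Abelianization.of g = ∏ x ∈ X, Abelianization.of x ^ a x := by
    have hg : g ∈ Subgroup.closure (X : Set G) := by simp [hX]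
    classical
    induction hg using Subgroup.closure_induction with
    | mem x hx =>
      refine ⟨Pi.single x 1, ?_⟩
      rw [Finset.prod_eq_single x]
      · simp
      · intro b _ hb; simp [hb]
      · intro h; exact absurd hx h
    | one => exact ⟨0, by simp⟩
    | mul x y _ _ ihx ihy =>
      obtain ⟨a, ha⟩ := ihx
      obtain ⟨b, hb⟩ := ihy
      exact ⟨a + b, by simp [ha, hb, zpow_add, Finset.prod_mul_distrib]⟩
    | inv x _ ih =>
      obtain ⟨a, ha⟩ := ih
      exact ⟨-a, by simp [ha]⟩
  obtain ⟨a, ha⟩ := key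
  refine ⟨g * (X.toList.map fun x => x ^ a x).prod⁻¹, ?_, a, by simp⟩
  rw [← Abelianization.ker_of, MonoidHom.mem_ker, map_mul, map_inv, map_list_prod, List.map_map, ha,
    mul_inv_eq_one, ← Finset.prod_map_toList]
  simp [Function.comp_def]

end Commutators

/-! ### Structure of the wreath product -/

namespace restrictedWreath

section Base

variable {D Q : Type*} [Group D] [Group Q]

/-- The element of `D ≀ Q` given by a finitely supported function `f : Q → D`. -/
def base (f : Q → D) (hf : (Function.mulSupport f).Finite) : restrictedWreath D Q :=
  ⟨⟨f, 1⟩, hf⟩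

@[ext]
lemma ext {a b : restrictedWreath D Q} (h₁ : ∀ z, a.1.left z = b.1.left z)
    (h₂ : a.1.right = b.1.right) : a = b :=
  Subtype.ext (RegularWreathProduct.ext (funext h₁) h₂)

/-- The inclusion of `Q` as a homomorphism. -/
def topHom : Q →* restrictedWreath D Q where
  toFun := ofTop
  map_one' := rfl
  map_mul' a b := by ext <;> simp [ofTop]

@[simp]
lemma topHom_left (q : Q) : (topHom q : restrictedWreath D Q).1.left = 1 := rfl

@[simp]
lemma topHom_right (q : Q) : (topHom q : restrictedWreath D Q).1.right = q := rfl

/-- The inclusion of `D` at the coordinate `1` as a homomorphism. -/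
noncomputable def baseHom : D →* restrictedWreath D Q where
  toFun := ofBase
  map_one' := by ext <;> simp [ofBase]
  map_mul' a b := by classical ext <;> simp [ofBase, Pi.mulSingle_mul]

lemma eq_base_mul_topHom (a : restrictedWreath D Q) :
    a = base a.1.left a.2 * topHom a.1.right := by
  ext <;> simp [base]

lemma base_eq_baseHom {f : Q → D} {hf : (Function.mulSupport f).Finite}
    (h : ∀ z, f z ≠ 1 → z = 1) : base f hf = baseHom (f 1) := by
  classical
  ext z
  · by_cases hz : z = 1
    · subst hz; simp [base, baseHom, ofBase]
    · simpa [base, baseHom, ofBase, hz] using not_imp_comm.1 (h z) hz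
  · rfl

open scoped commutatorElement in
@[simp]
lemma commutator_base_topHom_left (f : Q → D) (hf : (Function.mulSupport f).Finite) (t z : Q) :
    (⁅base f hf, topHom t⁆ : restrictedWreath D Q).1.left z = f z * (f (t⁻¹ * z))⁻¹ := by
  simp [commutatorElement_def, base]

open scoped commutatorElement in
@[simp]
lemma commutator_base_topHom_right (f : Q → D) (hf : (Function.mulSupport f).Finite) (t : Q) :
    (⁅base f hf, topHom t⁆ : restrictedWreath D Q).1.right = 1 := by
  simp [commutatorElement_def, base]

lemma base_mem_of_baseHom_mem {K : Subgroup (restrictedWreath D Q)}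
    (hb : ∀ y, baseHom y ∈ K) (ht : ∀ q, topHom q ∈ K)
    (f : Q → D) (hf : (Function.mulSupport f).Finite) : base f hf ∈ K := by
  classical
  have key : ∀ s : Finset Q, ∀ f : Q → D, ∀ hf : (Function.mulSupport f).Finite,
      Function.mulSupport f ⊆ s → base f hf ∈ K := by
    intro s
    induction s using Finset.induction_on with
    | empty =>
      intro f hf h
      have h1 : f = 1 := by simpa using h
      subst h1
      exact K.one_mem
    | insert q s _ ih =>
      intro f hf h
      have hsub : Function.mulSupport (Function.update f q 1) ⊆ Function.mulSupport f := by
        intro z hz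
        by_cases hzq : z = q
        · subst hzq; simp at hz
        · simpa [hzq] using hz
      have e : base f hf = topHom q * baseHom (f q) * (topHom q)⁻¹ *
          base (Function.update f q 1) (hf.subset hsub) := by
        ext z
        · by_cases hzq : z = q
          · subst hzq; simp [base, baseHom, ofBase]
          · have : q⁻¹ * z ≠ 1 := fun h => hzq (inv_mul_eq_one.1 h).symm
            simp [base, baseHom, ofBase, hzq, this]
        · simp [base, baseHom, ofBase]
      rw [e]
      refine K.mul_mem (K.mul_mem (K.mul_mem (ht q) (hb _)) (K.inv_mem (ht q))) (ih _ _ ?_)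
      intro z hz
      have hzq : z ≠ q := by rintro rfl; simp at hz
      exact (Finset.mem_insert.1 (h (hsub hz))).resolve_left hzq
  exact key hf.toFinset f hf (by simp)

end Base

/-! ### Wreath products over the integer lattice -/

section IntegerLattice

variable {G : Type*} [Group G] {n : ℕ}

/-- The `i`-th standard generator of `ℤⁿ`. -/
def unitVec (i : Fin n) : Multiplicative (Fin n → ℤ) := Multiplicative.ofAdd (Pi.single i 1)

lemma topHom_eq_prod (q : Multiplicative (Fin n → ℤ)) :
    (topHom q : restrictedWreath G (Multiplicative (Fin n → ℤ))) =
      ((List.finRange n).map fun i => topHom (unitVec i) ^ (q.toAdd i)).prod := by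
  have h : q = ((List.finRange n).map fun i => unitVec i ^ (q.toAdd i)).prod := by
    rw [← List.ofFn_eq_map, List.prod_ofFn]
    apply Multiplicative.toAdd.injective
    rw [toAdd_prod]
    ext j
    simp [unitVec, Finset.sum_apply, Pi.single_apply]
  conv_lhs => rw [h, map_list_prod, List.map_map]
  simp [Function.comp_def]

lemma topHom_unitVec_mem (X : Set G) (i : Fin n) :
    topHom (unitVec i) ∈ naturalGenerators X (standardGenerators n) :=
  Or.inr ⟨_, ⟨i, rfl⟩, rfl⟩

lemma baseHom_mem {X : Set G} {x : G} (hx : x ∈ X) :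
    baseHom x ∈ naturalGenerators X (standardGenerators n) :=
  Or.inl ⟨x, hx, rfl⟩

lemma closure_naturalGenerators {X : Set G} (hX : Subgroup.closure X = ⊤) :
    Subgroup.closure (naturalGenerators X (standardGenerators n)) = ⊤ := by
  rw [eq_top_iff]
  intro a _
  have ht : ∀ q, topHom q ∈ Subgroup.closure (naturalGenerators X (standardGenerators n)) := by
    intro q
    rw [topHom_eq_prod]
    refine Subgroup.list_prod_mem _ fun b hb => ?_
    obtain ⟨i, -, rfl⟩ := List.mem_map.1 hb
    exact Subgroup.zpow_mem _ (Subgroup.subset_closure (topHom_unitVec_mem X i)) _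
  have hb : ∀ y, baseHom y ∈ Subgroup.closure (naturalGenerators X (standardGenerators n)) := by
    intro y
    have hy : y ∈ Subgroup.closure X := by simp [hX]
    have hle : Subgroup.closure X ≤
        (Subgroup.closure (naturalGenerators X (standardGenerators n))).comap baseHom :=
      (Subgroup.closure_le _).2 fun x hx => Subgroup.subset_closure (baseHom_mem hx)
    exact hle hy
  rw [eq_base_mul_topHom a]
  exact Subgroup.mul_mem _ (base_mem_of_baseHom_mem hb ht _ _) (ht _)

/-- Partial products taken from both ends of each line keep the support finite; they need not match
where they meet, so `z_i = 0` is excluded. The last clause ensures that coordinates already cleared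
stay cleared. -/
lemma exists_telescope (h : Multiplicative (Fin n → ℤ) → G)
    (hh : (Function.mulSupport h).Finite) (i : Fin n) :
    ∃ f : Multiplicative (Fin n → ℤ) → G, (Function.mulSupport f).Finite ∧
      (∀ z, z.toAdd i ≠ 0 → f z * (f ((unitVec i)⁻¹ * z))⁻¹ = h z) ∧
      ∀ z, f z ≠ 1 → ∃ k : ℤ, h (unitVec i ^ k * z) ≠ 1 := by
  set t := unitVec i with ht
  have hti : ∀ (k : ℤ) (z : Multiplicative (Fin n → ℤ)),
      (t ^ k * z).toAdd i = k + z.toAdd i := by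
    intro k z; simp [ht, unitVec]
  obtain ⟨N, hN⟩ : ∃ N : ℕ, ∀ z, h z ≠ 1 → (z.toAdd i).natAbs < N := by
    obtain ⟨N, hN⟩ := (hh.image fun z => (z.toAdd i).natAbs).bddAbove
    exact ⟨N + 1, fun z hz => Nat.lt_succ_of_le (hN ⟨z, hz, rfl⟩)⟩
  have hN' : ∀ z, N ≤ (z.toAdd i).natAbs → h z = 1 := fun z hz => by
    by_contra hc; exact absurd (hN z hc) (by omega)
  -- Products of length `N` already reach past the support of `h`, so a shift of the window only
  -- splits off the first factor.
  have shift : ∀ a : ℕ → G, a N = 1 →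
      ((List.range N).map a).prod = a 0 * ((List.range N).map fun k => a (k + 1)).prod := by
    intro a ha
    have := (List.prod_range_succ a N).symm.trans (List.prod_range_succ' a N)
    simpa [ha] using this
  -- Formally `h(z) h(t⁻¹z) h(t⁻²z) ⋯` on the negative side and `h(tz)⁻¹ h(t²z)⁻¹ ⋯` on the other;
  -- both satisfy `f(z) = h(z) f(t⁻¹z)`.
  let f : Multiplicative (Fin n → ℤ) → G := fun z =>
    if z.toAdd i < 0 then ((List.range N).map fun k : ℕ => h (t ^ (-(k : ℤ)) * z)).prod
    else ((List.range N).map fun k : ℕ => (h (t ^ ((k : ℤ) + 1) * z))⁻¹).prod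
  have hf : ∀ z, f z ≠ 1 → ∃ k ∈ Finset.Icc (-(N : ℤ)) N, h (t ^ k * z) ≠ 1 := by
    intro z hz
    by_contra! hc
    apply hz
    simp only [f]
    split_ifs
    · refine List.prod_eq_one fun x hx => ?_
      obtain ⟨k, hk, rfl⟩ := List.mem_map.1 hx
      have := List.mem_range.1 hk
      exact hc _ (Finset.mem_Icc.2 (by omega))
    · refine List.prod_eq_one fun x hx => ?_
      obtain ⟨k, hk, rfl⟩ := List.mem_map.1 hx
      have := List.mem_range.1 hk
      rw [inv_eq_one]
      exact hc _ (Finset.mem_Icc.2 (by omega))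
  refine ⟨f, ?_, ?_, fun z hz => (hf z hz).imp fun k hk => hk.2⟩
  · refine (Set.Finite.biUnion (Finset.Icc (-(N : ℤ)) N).finite_toSet
      fun k _ => hh.preimage (mul_right_injective (t ^ k)).injOn).subset fun z hz => ?_
    obtain ⟨k, hk, hk'⟩ := hf z hz
    exact Set.mem_biUnion hk hk'
  · intro z hz
    have hz1 : (t⁻¹ * z).toAdd i = -1 + z.toAdd i := by simpa using hti (-1) z
    rw [mul_inv_eq_iff_eq_mul]
    rcases lt_or_gt_of_ne hz with hneg | hpos
    · have h2 : (t⁻¹ * z).toAdd i < 0 := by omega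
      simp only [f, if_pos hneg, if_pos h2]
      rw [shift _ (hN' _ (by rw [hti]; omega))]
      congr 1
      · simp
      · refine congrArg List.prod (List.map_congr_left fun k _ => congrArg h ?_)
        rw [← mul_assoc, ← zpow_neg_one, ← zpow_add]
        congr 2; push_cast; ring
    · have h1 : ¬ z.toAdd i < 0 := by omega
      have h2 : ¬ (t⁻¹ * z).toAdd i < 0 := by omega
      simp only [f, if_neg h1, if_neg h2]
      have e : ((List.range N).map fun k : ℕ => (h (t ^ ((k : ℤ) + 1) * (t⁻¹ * z)))⁻¹) =
          (List.range N).map fun k : ℕ => (h (t ^ (k : ℤ) * z))⁻¹ := by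
        refine List.map_congr_left fun k _ => ?_
        rw [← mul_assoc, zpow_add_one, mul_inv_cancel_right]
      rw [e, shift (fun k : ℕ => (h (t ^ (k : ℤ) * z))⁻¹)
        (inv_eq_one.2 (hN' _ (by rw [hti]; omega)))]
      simp

/-- The partial products `u_{m+1} u_{m+2} ⋯` of a list, extended by `1` to negative `m`. -/
def tailProd (L : List G) (m : ℤ) : G := if 0 ≤ m then (L.drop m.toNat).prod else 1

lemma tailProd_mul_inv_of_pos {L : List G} {m : ℤ} (hm : 0 < m) :
    tailProd L m * (tailProd L (-1 + m))⁻¹ = (L.getD (m.toNat - 1) 1)⁻¹ := by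
  obtain ⟨k, rfl⟩ : ∃ k : ℕ, m = k + 1 := ⟨(m - 1).toNat, by omega⟩
  have e1 : ((k : ℤ) + 1).toNat = k + 1 := by omega
  have e2 : (-1 + ((k : ℤ) + 1)).toNat = k := by omega
  rw [tailProd, tailProd, if_pos (by omega), if_pos (by omega), e1, e2]
  rcases lt_or_ge k L.length with hk | hk
  · rw [List.drop_eq_getElem_cons hk]
    simp [hk]
  · simp [hk, List.drop_eq_nil_of_le, Nat.le_succ_of_le]

open Classical in
/-- `tailProd` on the line through `unitVec i`. -/
noncomputable def lineProd (i : Fin n) (L : List G) (z : Multiplicative (Fin n → ℤ)) : G :=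
  if z = unitVec i ^ (z.toAdd i) then tailProd L (z.toAdd i) else 1

lemma finite_mulSupport_lineProd (i : Fin n) (L : List G) :
    (Function.mulSupport (lineProd i L)).Finite := by
  refine (((Finset.Icc (0 : ℤ) L.length).finite_toSet).image fun k => unitVec i ^ k).subset ?_
  intro z hz
  by_cases h : z = unitVec i ^ (z.toAdd i)
  · refine ⟨z.toAdd i, ?_, h.symm⟩
    rw [Function.mem_mulSupport, lineProd, if_pos h, tailProd] at hz
    rw [Finset.mem_coe, Finset.mem_Icc]
    by_contra hc
    apply hz
    split_ifs with h0
    · rw [List.drop_eq_nil_of_le (by omega), List.prod_nil]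
    · rfl
  · exact absurd (by rw [lineProd, if_neg h]) hz

open scoped commutatorElement in
-- At position `m > 0` of the line the two commutators take the values `u_m` and `u_m⁻¹`, which
-- cancel. At `0` they give the full products of the two lists, `u₁⁻¹ ⋯ u_k⁻¹` and `1`.
lemma baseHom_eq_mul_commutators (i : Fin n) {L : List G} (hL : L.prod = 1) :
    (baseHom (L.map (·⁻¹)).prod : restrictedWreath G (Multiplicative (Fin n → ℤ))) =
      ⁅base (lineProd i (L.map (·⁻¹))) (finite_mulSupport_lineProd _ _), topHom (unitVec i)⁆ *
      ⁅base (lineProd i L) (finite_mulSupport_lineProd _ _), topHom (unitVec i)⁆ := by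
  classical
  ext z
  · have hs : ((unitVec i)⁻¹ * z).toAdd i = -1 + z.toAdd i := by simp [unitVec]
    have hiff : (unitVec i)⁻¹ * z = unitVec i ^ (-1 + z.toAdd i) ↔
        z = unitVec i ^ (z.toAdd i) := by
      rw [zpow_add, zpow_neg_one, mul_right_inj]
    simp only [Subgroup.coe_mul, RegularWreathProduct.mul_left, Pi.mul_apply,
      commutator_base_topHom_left, commutator_base_topHom_right, inv_one, one_mul, lineProd, hs,
      hiff]
    by_cases hz : z = unitVec i ^ (z.toAdd i)
    · simp only [if_pos hz]
      rcases lt_trichotomy (z.toAdd i) 0 with h | h | h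
      · have hz1 : z ≠ 1 := by rintro rfl; simp at h
        simp [tailProd, baseHom, ofBase, hz1, not_le.2 h, show ¬ (0 ≤ -1 + z.toAdd i) by omega]
      · have hz1 : z = 1 := by rw [hz, h, zpow_zero]
        simp [tailProd, baseHom, ofBase, hz1, hL]
      · have hz1 : z ≠ 1 := by rintro rfl; simp at h
        rw [tailProd_mul_inv_of_pos h, tailProd_mul_inv_of_pos h]
        have : (L.map (·⁻¹)).getD ((z.toAdd i).toNat - 1) 1 =
            (L.getD ((z.toAdd i).toNat - 1) 1)⁻¹ := by
          simp only [List.getD_eq_getElem?_getD, List.getElem?_map]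
          cases L[(z.toAdd i).toNat - 1]? <;> simp
        rw [this]
        simp [baseHom, ofBase, hz1]
    · have hz1 : z ≠ 1 := by rintro rfl; simp at hz
      simp [if_neg hz, baseHom, ofBase, hz1]
  · simp [baseHom, ofBase]

variable {X : Set G}

open scoped commutatorElement in
/-- Up to three palindromes for each coordinate in `s`, a finitely supported function can be
moved to the subgroup where the coordinates in `s` vanish. -/
lemma exists_base_eq_mul_base (hX : Subgroup.closure X = ⊤) (s : Finset (Fin n))
    (h : Multiplicative (Fin n → ℤ) → G) (hh : (Function.mulSupport h).Finite) :
    ∃ (a : restrictedWreath G (Multiplicative (Fin n → ℤ)))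
      (f : Multiplicative (Fin n → ℤ) → G) (hf : (Function.mulSupport f).Finite),
      IsPalindromeProduct (naturalGenerators X (standardGenerators n)) (3 * s.card) a ∧
      base h hh = a * base f hf ∧ ∀ z, f z ≠ 1 → ∀ i ∈ s, z.toAdd i = 0 := by
  induction s using Finset.induction_on with
  | empty => exact ⟨1, h, hh, ⟨[], by simp, by simp, by simp⟩, by simp, by simp⟩
  | insert i s his ih =>
    obtain ⟨a, f, hf, ha, hbase, hfs⟩ := ih
    obtain ⟨u, hu, hu1, hu2⟩ := exists_telescope f hf i
    -- What is left of `f` after the commutator is divided out on the left; it is trivial wherever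
    -- `z_i ≠ 0`.
    let f' : Multiplicative (Fin n → ℤ) → G :=
      fun z => (u z * (u ((unitVec i)⁻¹ * z))⁻¹)⁻¹ * f z
    have hus : ∀ z, ∀ j ∈ s, z.toAdd j ≠ 0 → u z = 1 := by
      intro z j hj hz
      by_contra hc
      obtain ⟨k, hk⟩ := hu2 z hc
      have hji : j ≠ i := fun e => his (e ▸ hj)
      apply hz
      simpa [unitVec, hji] using hfs _ hk j hj
    have hf' : (Function.mulSupport f').Finite := by
      refine ((hu.union (hu.preimage (mul_right_injective (unitVec i)⁻¹).injOn)).union hf).subset ?_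
      intro z hz
      by_contra hc
      simp only [Set.mem_union, Set.mem_preimage, Function.mem_mulSupport, not_or, not_not] at hc
      exact hz (by simp [f', hc.1.1, hc.1.2, hc.2])
    refine ⟨a * ⁅base u hu, topHom (unitVec i)⁆, f', hf', ?_, ?_, ?_⟩
    · rw [Finset.card_insert_of_notMem his, mul_add]
      exact ha.mul (isPalindromeProduct_commutator (by simp [closure_naturalGenerators hX])
        (topHom_unitVec_mem X i))
    · rw [hbase, mul_assoc]
      congr 1
      ext z
      · simp only [Subgroup.coe_mul, RegularWreathProduct.mul_left, Pi.mul_apply,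
          commutator_base_topHom_left, commutator_base_topHom_right, inv_one, one_mul]
        simp [base, f', mul_assoc]
      · rw [Subgroup.coe_mul, RegularWreathProduct.mul_right, commutator_base_topHom_right, one_mul]
        rfl
    · intro z hz j hj
      by_contra hc
      apply hz
      rcases Finset.mem_insert.1 hj with rfl | hj
      · simp only [f', hu1 z hc, inv_mul_cancel]
      · have hji : j ≠ i := fun e => his (e ▸ hj)
        have h1 := hus z j hj hc
        have h2 := hus ((unitVec i)⁻¹ * z) j hj (by simpa [unitVec, hji] using hc)
        have h3 : f z = 1 := by by_contra h; exact hc (hfs z h j hj)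
        simp [f', h1, h2, h3]

lemma isPalindromeProduct_baseHom (X : Finset G) (hX : Subgroup.closure (X : Set G) = ⊤)
    (i : Fin n) (g : G) :
    IsPalindromeProduct (naturalGenerators (X : Set G) (standardGenerators n)) (6 + X.card)
      (baseHom g) := by
  obtain ⟨c, hc, a, rfl⟩ := exists_mem_commutator_mul_prod_zpow X hX g
  obtain ⟨L, hL, rfl⟩ := exists_list_prod_eq_one_of_mem_commutator hc
  rw [map_mul]
  refine IsPalindromeProduct.mul (m := 3 + 3) ?_ ?_
  · rw [baseHom_eq_mul_commutators i hL]
    exact (isPalindromeProduct_commutator (by simp [closure_naturalGenerators hX])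
      (topHom_unitVec_mem _ i)).mul (isPalindromeProduct_commutator
      (by simp [closure_naturalGenerators hX]) (topHom_unitVec_mem _ i))
  · rw [map_list_prod, List.map_map, ← Finset.length_toList, ← one_mul X.toList.length]
    refine isPalindromeProduct_list_prod _ _ fun x hx => ?_
    rw [Function.comp_apply, map_zpow]
    exact (isPalindromeIn_zpow (baseHom_mem (by simpa using hx)) _).isPalindromeProduct

lemma isPalindromeProduct_naturalGenerators (hn : 1 ≤ n) (X : Finset G)
    (hX : Subgroup.closure (X : Set G) = ⊤)
    (a : restrictedWreath G (Multiplicative (Fin n → ℤ))) :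
    IsPalindromeProduct (naturalGenerators (X : Set G) (standardGenerators n))
      (X.card + 4 * n + 6) a := by
  rw [eq_base_mul_topHom a]
  obtain ⟨b, f, hf, hb, hbase, hfs⟩ := exists_base_eq_mul_base hX Finset.univ _ a.2
  rw [hbase, base_eq_baseHom fun z hz => Multiplicative.toAdd.injective
    (funext fun i => hfs z hz i (Finset.mem_univ i)), topHom_eq_prod]
  refine ((hb.mul (isPalindromeProduct_baseHom X hX ⟨0, hn⟩ _)).mul
    (isPalindromeProduct_list_prod (k := 1) _ _ fun i _ =>
      (isPalindromeIn_zpow (topHom_unitVec_mem _ i) _).isPalindromeProduct)).mono ?_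
  simp only [Finset.card_univ, Fintype.card_fin, List.length_finRange]
  omega

end IntegerLattice

end restrictedWreath

theorem mainTheorem2 {G : Type*} [Group G] (d n : ℕ) (hn : 1 ≤ n)
    (X : Finset G) (hXd : X.card ≤ d) (hX : Subgroup.closure (X : Set G) = ⊤) :
    (Even n → palindromicWidth (restrictedWreath.naturalGenerators (X : Set G)
      (standardGenerators n)) ≤ ((5 * d + 9 * n : ℕ) : ℕ∞)) ∧
    (Odd n → palindromicWidth (restrictedWreath.naturalGenerators (X : Set G)
      (standardGenerators n)) ≤ ((5 * d + 9 * n + 2 : ℕ) : ℕ∞)) := by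
  have key : ∀ m, X.card + 4 * n + 6 ≤ m → palindromicWidth
      (restrictedWreath.naturalGenerators (X : Set G) (standardGenerators n)) ≤ (m : ℕ∞) :=
    fun m hm => iInf₂_le m fun a =>
      (restrictedWreath.isPalindromeProduct_naturalGenerators hn X hX a).mono hm
  -- The bound `4n + 6 ≤ 9n` needs `n ≥ 2`, which evenness and `n ≥ 1` supply; for odd `n` the extra
  -- `2` covers `n = 1`.
  refine ⟨fun he => key _ ?_, fun _ => key _ (by omega)⟩
  obtain ⟨k, rfl⟩ := he
  omega
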